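/- For $J\subseteq[n]=\{1,\dots,n\}$ let $\mathcal S_J$ be the set of permutations of $[n]$ that fix every element outside $J$, and for $x\in\{0,1\}^n$ and a permutation $\pi$ let $\pi x$ be the vector whose $\pi(i)$-th coordinate is $x_i$. For $f:\{0,1\}^n\to\{0,1\}$ define the symmetric influence $$\mathrm{SymInf}_f(J)=\Pr_{x\in\{0,1\}^n,\ \pi\in\mathcal S_J}\bigl[f(x)\neq f(\pi x)\bigr],$$ where $x$ and $\pi$ are independent and uniformly distributed. **Lemma (weak sub-additivity).** There is a universal constant $c$ such that for every $0<\gamma<1$, every $n$, every function $f:\{0,1\}^n\to\{0,1\}$, and all sets $J,K\subseteq[n]$ of size at least $(1-\gamma)n$, $$\mathrm{SymInf}_f(J\cup K)\le \mathrm{SymInf}_f(J)+\mathrm{SymInf}_f(K)+c\sqrt{\gamma}.$$ -/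

import Mathlib

/-- The set `𝒮_J` of the permutations of `[n]` that only move elements of `J`. -/
def permsOn {n : ℕ} (J : Finset (Fin n)) : Finset (Equiv.Perm (Fin n)) :=
  Finset.univ.filter fun π => ∀ i, i ∉ J → π i = i

/-- The vector `π x`, whose `π i`-th coordinate is `x i`. -/
def permVec {n : ℕ} (π : Equiv.Perm (Fin n)) (x : Fin n → Bool) : Fin n → Bool :=
  fun i => x (π.symm i)

theorem permVec_apply_apply {n : ℕ} (π : Equiv.Perm (Fin n)) (x : Fin n → Bool) (i : Fin n) :
    permVec π x (π i) = x i := by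
  simp [permVec]

theorem permsOn_nonempty {n : ℕ} (J : Finset (Fin n)) : (permsOn J).Nonempty :=
  ⟨1, by simp [permsOn]⟩

/-- The symmetric influence of `J` in `f`: the probability that `f x ≠ f (π x)` for `(x, π)`
uniform in `{0,1}^n × 𝒮_J`, a finite nonempty set. -/
noncomputable def SymInf {n : ℕ} (f : (Fin n → Bool) → Bool) (J : Finset (Fin n)) : ℝ :=
  ((((Finset.univ : Finset (Fin n → Bool)) ×ˢ permsOn J).filter
      fun p => f p.1 ≠ f (permVec p.2 p.1)).card : ℝ) /
    ((Finset.univ : Finset (Fin n → Bool)) ×ˢ permsOn J).card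

/-! With `F` the indicator of `f`, averaging over `𝒮_J` is an orthogonal projection `P_J`, and
`SymInf f J` is a multiple of `⟨F, (1 - P_J) F⟩` (`symInf_eq`). After removing the `𝒮_{J ∪
K}`-invariant part, it remains to show `P_J + P_K ≤ 1 + ε`, where `ε` bounds the cosine of the angle
between the two ranges.

The angle comes from coupling: for an `𝒮_J`-invariant function, `P_K` shrinks the effect of a swap
by `|K \ J| / |K|` (`SwapLipschitz.symmetrize`). So powers of `P_K P_J` decay like those of
`gapRatio`, and self-adjointness turns this decay into an L² bound (`symmetrize_norm_sq_le`). Hence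
`ε = √gapRatio`, which is `O(γ)` for large sets. -/

/-! ### The groups `𝒮_J` and their action on the cube. -/

section Perms

variable {n : ℕ} {J K : Finset (Fin n)}

theorem mem_permsOn {π : Equiv.Perm (Fin n)} : π ∈ permsOn J ↔ ∀ i, i ∉ J → π i = i := by
  simp [permsOn]

theorem permsOn_mono (h : J ⊆ K) : permsOn J ⊆ permsOn K := fun _ hπ =>
  mem_permsOn.2 fun i hi => mem_permsOn.1 hπ i fun hj => hi (h hj)

theorem mul_mem_permsOn {π σ : Equiv.Perm (Fin n)} (hπ : π ∈ permsOn J) (hσ : σ ∈ permsOn J) :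
    π * σ ∈ permsOn J := by
  rw [mem_permsOn] at *
  intro i hi
  rw [Equiv.Perm.mul_apply, hσ i hi, hπ i hi]

theorem inv_mem_permsOn {π : Equiv.Perm (Fin n)} (hπ : π ∈ permsOn J) : π⁻¹ ∈ permsOn J := by
  rw [mem_permsOn] at *
  intro i hi
  rw [Equiv.Perm.inv_eq_iff_eq, hπ i hi]

theorem swap_mem_permsOn {i j : Fin n} (hi : i ∈ J) (hj : j ∈ J) :
    Equiv.swap i j ∈ permsOn J := by
  rw [mem_permsOn]
  intro k hk
  exact Equiv.swap_apply_of_ne_of_ne (fun h => hk (h ▸ hi)) (fun h => hk (h ▸ hj))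

theorem apply_mem_of_mem_permsOn {π : Equiv.Perm (Fin n)} (hπ : π ∈ permsOn J) {i : Fin n}
    (hi : i ∈ J) : π i ∈ J := by
  by_contra h
  have := mem_permsOn.1 hπ _ h
  exact h (by rwa [π.injective this])

theorem card_permsOn_pos : 0 < ((permsOn J).card : ℝ) := by
  exact_mod_cast (permsOn_nonempty J).card_pos

theorem sum_permsOn_mul_right {σ : Equiv.Perm (Fin n)} (hσ : σ ∈ permsOn J)
    (F : Equiv.Perm (Fin n) → ℝ) :
    ∑ π ∈ permsOn J, F (π * σ) = ∑ π ∈ permsOn J, F π := by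
  refine Finset.sum_nbij' (· * σ) (· * σ⁻¹) ?_ ?_ ?_ ?_ ?_
  · intro π hπ; exact mul_mem_permsOn hπ hσ
  · intro π hπ; exact mul_mem_permsOn hπ (inv_mem_permsOn hσ)
  · intro π _; simp
  · intro π _; simp
  · intro π _; rfl

theorem sum_permsOn_mul_left {σ : Equiv.Perm (Fin n)} (hσ : σ ∈ permsOn J)
    (F : Equiv.Perm (Fin n) → ℝ) :
    ∑ π ∈ permsOn J, F (σ * π) = ∑ π ∈ permsOn J, F π := by
  refine Finset.sum_nbij' (σ * ·) (σ⁻¹ * ·) ?_ ?_ ?_ ?_ ?_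
  · intro π hπ; exact mul_mem_permsOn hσ hπ
  · intro π hπ; exact mul_mem_permsOn (inv_mem_permsOn hσ) hπ
  · intro π _; simp
  · intro π _; simp
  · intro π _; rfl

theorem sum_permsOn_inv (F : Equiv.Perm (Fin n) → ℝ) :
    ∑ π ∈ permsOn J, F π⁻¹ = ∑ π ∈ permsOn J, F π := by
  refine Finset.sum_nbij' (·⁻¹) (·⁻¹) ?_ ?_ ?_ ?_ ?_
  · intro π hπ; exact inv_mem_permsOn hπ
  · intro π hπ; exact inv_mem_permsOn hπ
  · intro π _; simp
  · intro π _; simp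
  · intro π _; rfl

theorem permVec_mul (π σ : Equiv.Perm (Fin n)) (x : Fin n → Bool) :
    permVec (π * σ) x = permVec π (permVec σ x) := rfl

theorem permVec_inv_permVec (π : Equiv.Perm (Fin n)) (x : Fin n → Bool) :
    permVec π⁻¹ (permVec π x) = x := by
  rw [← permVec_mul, inv_mul_cancel]; rfl

theorem permVec_permVec_inv (π : Equiv.Perm (Fin n)) (x : Fin n → Bool) :
    permVec π (permVec π⁻¹ x) = x := by
  rw [← permVec_mul, mul_inv_cancel]; rfl

theorem sum_permVec (π : Equiv.Perm (Fin n)) (h : (Fin n → Bool) → ℝ) :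
    ∑ x, h (permVec π x) = ∑ x, h x :=
  Fintype.sum_equiv ⟨permVec π, permVec π⁻¹, permVec_inv_permVec π, permVec_permVec_inv π⟩ _ _
    fun _ => rfl

/-- A uniform element of `𝒮_K` sends a fixed element of `K` to a uniform element of `K`. -/
theorem card_mul_sum_permsOn_indicator (B : Finset (Fin n)) (hB : B ⊆ K) {j : Fin n}
    (hj : j ∈ K) :
    (K.card : ℝ) * ∑ π ∈ permsOn K, (if π j ∈ B then (1 : ℝ) else 0) =
      B.card * (permsOn K).card := by
  have h1 : ∀ k ∈ K, ∑ π ∈ permsOn K, (if π k ∈ B then (1 : ℝ) else 0) =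
      ∑ π ∈ permsOn K, (if π j ∈ B then (1 : ℝ) else 0) := by
    intro k hk
    -- Precomposing with the swap of `j` and `k` turns `π k` into `π j`.
    rw [← sum_permsOn_mul_right (swap_mem_permsOn hj hk)]
    simp
  have h2 : ∀ π ∈ permsOn K, ∑ k ∈ K, (if π k ∈ B then (1 : ℝ) else 0) = B.card := by
    intro π hπ
    rw [Finset.sum_ite, Finset.sum_const_zero, add_zero, Finset.sum_const, nsmul_eq_mul, mul_one]
    congr 1
    refine Finset.card_nbij' π π.symm ?_ ?_ ?_ ?_
    · intro k hk
      simpa using (Finset.mem_filter.1 hk).2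
    · intro k hk
      have := apply_mem_of_mem_permsOn (inv_mem_permsOn hπ) (hB hk)
      simp only [Finset.coe_filter, Set.mem_ofPred_eq, Equiv.apply_symm_apply]
      exact ⟨this, hk⟩
    · intro k _; simp
    · intro k _; simp
  calc (K.card : ℝ) * ∑ π ∈ permsOn K, (if π j ∈ B then (1 : ℝ) else 0)
      = ∑ k ∈ K, ∑ π ∈ permsOn K, (if π k ∈ B then (1 : ℝ) else 0) := by
        rw [Finset.sum_congr rfl h1, Finset.sum_const, nsmul_eq_mul]
    _ = ∑ π ∈ permsOn K, ∑ k ∈ K, (if π k ∈ B then (1 : ℝ) else 0) := Finset.sum_comm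
    _ = _ := by
        rw [Finset.sum_congr rfl h2, Finset.sum_const, nsmul_eq_mul, mul_comm]

end Perms

/-! ### Averaging over `𝒮_J` as an orthogonal projection. -/

section Symmetrize

variable {n : ℕ} {J U : Finset (Fin n)}

/-- The average of a function over the action of `𝒮_J`. -/
noncomputable def symmetrize (J : Finset (Fin n)) :
    ((Fin n → Bool) → ℝ) →ₗ[ℝ] ((Fin n → Bool) → ℝ) where
  toFun h x := (∑ π ∈ permsOn J, h (permVec π x)) / (permsOn J).card
  map_add' g h := by
    ext x
    simp [Finset.sum_add_distrib, add_div]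
  map_smul' c h := by
    ext x
    simp [← Finset.mul_sum, mul_div_assoc]

theorem symmetrize_apply (h : (Fin n → Bool) → ℝ) (x : Fin n → Bool) :
    symmetrize J h x = (∑ π ∈ permsOn J, h (permVec π x)) / (permsOn J).card := rfl

/-- Invariance under the action of `𝒮_J`. -/
def PermInvariant (J : Finset (Fin n)) (h : (Fin n → Bool) → ℝ) : Prop :=
  ∀ π ∈ permsOn J, ∀ x, h (permVec π x) = h x

theorem permInvariant_symmetrize (h : (Fin n → Bool) → ℝ) :
    PermInvariant J (symmetrize J h) := by
  intro σ hσ x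
  rw [symmetrize_apply, symmetrize_apply]
  congr 1
  exact sum_permsOn_mul_right hσ fun π => h (permVec π x)

theorem PermInvariant.mono {h : (Fin n → Bool) → ℝ} (hh : PermInvariant U h) (hJ : J ⊆ U) :
    PermInvariant J h := fun π hπ => hh π (permsOn_mono hJ hπ)

theorem PermInvariant.symmetrize_eq {h : (Fin n → Bool) → ℝ} (hh : PermInvariant J h) :
    symmetrize J h = h := by
  ext x
  rw [symmetrize_apply, Finset.sum_congr rfl fun π hπ => hh π hπ x, Finset.sum_const,
    nsmul_eq_mul, mul_div_cancel_left₀ _ card_permsOn_pos.ne']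

theorem symmetrize_symmetrize_of_subset (hJ : J ⊆ U) (h : (Fin n → Bool) → ℝ) :
    symmetrize J (symmetrize U h) = symmetrize U h :=
  ((permInvariant_symmetrize h).mono hJ).symmetrize_eq

theorem symmetrize_self (h : (Fin n → Bool) → ℝ) :
    symmetrize J (symmetrize J h) = symmetrize J h :=
  symmetrize_symmetrize_of_subset subset_rfl h

theorem symmetrize_symmetrize_of_superset (hJ : J ⊆ U) (h : (Fin n → Bool) → ℝ) :
    symmetrize U (symmetrize J h) = symmetrize U h := by
  ext x
  rw [symmetrize_apply, symmetrize_apply]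
  congr 1
  simp only [symmetrize_apply]
  have e : ∀ σ ∈ permsOn J, ∑ π ∈ permsOn U, h (permVec σ (permVec π x)) =
      ∑ π ∈ permsOn U, h (permVec π x) := fun σ hσ =>
    sum_permsOn_mul_left (permsOn_mono hJ hσ) fun π => h (permVec π x)
  rw [← Finset.sum_div, Finset.sum_comm, div_eq_iff card_permsOn_pos.ne',
    Finset.sum_congr rfl e, Finset.sum_const, nsmul_eq_mul, mul_comm]

theorem symmetrize_dotProduct (g h : (Fin n → Bool) → ℝ) :
    symmetrize J g ⬝ᵥ h = g ⬝ᵥ symmetrize J h := by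
  simp only [dotProduct, symmetrize_apply, div_mul_eq_mul_div, mul_div_assoc', Finset.sum_mul,
    Finset.mul_sum]
  rw [← Finset.sum_div, ← Finset.sum_div, Finset.sum_comm, Finset.sum_comm (s := Finset.univ),
    ← sum_permsOn_inv]
  congr 1
  refine Finset.sum_congr rfl fun π _ => ?_
  rw [← sum_permVec π]
  simp only [permVec_inv_permVec]

theorem symmetrize_dotProduct_symmetrize (h : (Fin n → Bool) → ℝ) :
    symmetrize J h ⬝ᵥ symmetrize J h = h ⬝ᵥ symmetrize J h := by
  rw [symmetrize_dotProduct, symmetrize_self]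

theorem dotProduct_sq_le {ι : Type*} [Fintype ι] (g h : ι → ℝ) :
    (g ⬝ᵥ h) ^ 2 ≤ (g ⬝ᵥ g) * (h ⬝ᵥ h) := by
  simpa [dotProduct, sq] using Finset.sum_mul_sq_le_sq_mul_sq Finset.univ g h

theorem dotProduct_self_nonneg_real {ι : Type*} [Fintype ι] (g : ι → ℝ) : 0 ≤ g ⬝ᵥ g :=
  Finset.sum_nonneg fun i _ => mul_self_nonneg (g i)

end Symmetrize

/-! ### Contraction in the swap-Lipschitz seminorm. -/

section Contraction

variable {n : ℕ} {J K : Finset (Fin n)}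

/-- `h` changes by at most `d` when two coordinates in `U` are exchanged. -/
def SwapLipschitz (U : Finset (Fin n)) (d : ℝ) (h : (Fin n → Bool) → ℝ) : Prop :=
  ∀ i ∈ U, ∀ j ∈ U, ∀ x, |h (permVec (Equiv.swap i j) x) - h x| ≤ d

theorem exists_swapLipschitz (U : Finset (Fin n)) (h : (Fin n → Bool) → ℝ) :
    ∃ d, 0 ≤ d ∧ SwapLipschitz U d h := by
  refine ⟨∑ x, |h x| + ∑ x, |h x|, by positivity, fun i _ j _ x => ?_⟩
  have hb : ∀ y, |h y| ≤ ∑ x, |h x| := fun y =>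
    Finset.single_le_sum (f := fun x => |h x|) (fun x _ => abs_nonneg _) (Finset.mem_univ y)
  exact (abs_sub _ _).trans (add_le_add (hb _) (hb _))

/-- Symmetrizing over `K` a `𝒮_J`-invariant function contracts its swap-Lipschitz constant. -/
theorem SwapLipschitz.symmetrize {d : ℝ} (hd : 0 ≤ d) {h : (Fin n → Bool) → ℝ}
    (hJ : PermInvariant J h) (hU : SwapLipschitz (J ∪ K) d h) :
    SwapLipschitz (J ∪ K) ((K \ J).card / K.card * d) (symmetrize K h) := by
  have hinv := permInvariant_symmetrize (J := K) h
  have hr : 0 ≤ ((K \ J).card / K.card : ℝ) * d := by positivity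
  have mixed : ∀ i ∈ J \ K, ∀ j ∈ K, ∀ x,
      |_root_.symmetrize K h (permVec (Equiv.swap i j) x) - _root_.symmetrize K h x| ≤
        (K \ J).card / K.card * d := by
    intro i hi j hj x
    obtain ⟨hiJ, hiK⟩ := Finset.mem_sdiff.1 hi
    have hK : 0 < (K.card : ℝ) := by exact_mod_cast Finset.card_pos.2 ⟨j, hj⟩
    rw [symmetrize_apply, symmetrize_apply, ← sub_div, ← Finset.sum_sub_distrib, abs_div,
      abs_of_pos card_permsOn_pos, div_le_iff₀ card_permsOn_pos]
    have term : ∀ π ∈ permsOn K,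
        |h (permVec π (permVec (Equiv.swap i j) x)) - h (permVec π x)| ≤
          (if π j ∈ K \ J then 1 else 0) * d := by
      intro π hπ
      -- `π` fixes `i ∉ K`, so conjugation gives the swap of `i` and `π j`. It acts trivially on `h`
      -- unless `π j ∉ J`, which has probability `|K \ J| / |K|`.
      have e : permVec π (permVec (Equiv.swap i j) x) =
          permVec (Equiv.swap i (π j)) (permVec π x) := by
        rw [← permVec_mul, ← permVec_mul, Equiv.mul_swap_eq_swap_mul, mem_permsOn.1 hπ i hiK]
      have hπj := apply_mem_of_mem_permsOn hπ hj
      rw [e]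
      by_cases hm : π j ∈ J
      · rw [hJ _ (swap_mem_permsOn hiJ hm)]
        simp [hm]
      · rw [if_pos (Finset.mem_sdiff.2 ⟨hπj, hm⟩), one_mul]
        exact hU i (Finset.mem_union_left _ hiJ) _ (Finset.mem_union_right _ hπj) _
    refine (Finset.abs_sum_le_sum_abs _ _).trans ((Finset.sum_le_sum term).trans_eq ?_)
    rw [← Finset.sum_mul]
    have := card_mul_sum_permsOn_indicator (K \ J) Finset.sdiff_subset hj
    field_simp
    linear_combination d * this
  intro i hi j hj x
  by_cases hiK : i ∈ K <;> by_cases hjK : j ∈ K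
  · rw [hinv _ (swap_mem_permsOn hiK hjK)]
    simpa using hr
  · rw [Equiv.swap_comm]
    exact mixed j (by simp_all) i hiK x
  · exact mixed i (by simp_all) j hjK x
  · have hiJ : i ∈ J := by simp_all
    have hjJ : j ∈ J := by simp_all
    -- A swap inside `J \ K` commutes with `𝒮_K`.
    have e : ∀ π ∈ permsOn K, h (permVec π (permVec (Equiv.swap i j) x)) = h (permVec π x) := by
      intro π hπ
      rw [← permVec_mul, Equiv.mul_swap_eq_swap_mul, mem_permsOn.1 hπ i hiK,
        mem_permsOn.1 hπ j hjK, permVec_mul, hJ _ (swap_mem_permsOn hiJ hjJ)]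
    rw [symmetrize_apply, symmetrize_apply, Finset.sum_congr rfl e]
    simpa using hr

/-- `m` is the length of a factorization of `π` into swaps within `U`; it must not depend on `h` or
`d`, since it is applied to all iterates at once. -/
theorem exists_swap_length (U : Finset (Fin n)) (π : Equiv.Perm (Fin n)) (hπ : π ∈ permsOn U) :
    ∃ m : ℝ, 0 ≤ m ∧ ∀ d h, 0 ≤ d → SwapLipschitz U d h →
      ∀ x, |h (permVec π x) - h x| ≤ m * d := by
  have key : ∀ σ : Equiv.Perm {i // i ∈ U}, ∃ m : ℝ, 0 ≤ m ∧
      ∀ d h, 0 ≤ d → SwapLipschitz U d h →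
        ∀ x, |h (permVec (Equiv.Perm.ofSubtype σ) x) - h x| ≤ m * d := by
    intro σ
    induction σ using Equiv.Perm.swap_induction_on with
    | one =>
      refine ⟨0, le_rfl, fun d h _ _ x => ?_⟩
      rw [map_one]
      change |h x - h x| ≤ _
      simp
    | swap_mul σ i j _ ih =>
      obtain ⟨m, hm, ih⟩ := ih
      refine ⟨m + 1, by positivity, fun d h hd hh x => ?_⟩
      rw [map_mul, Equiv.Perm.ofSubtype_swap_eq, permVec_mul, add_mul, one_mul, add_comm]
      refine (abs_sub_le _ (h (permVec (Equiv.Perm.ofSubtype σ) x)) _).trans ?_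
      exact add_le_add (hh _ i.2 _ j.2 _) (ih d h hd hh x)
  have hU : ∀ i, i ∈ U ↔ π i ∈ U := fun i =>
    ⟨apply_mem_of_mem_permsOn hπ, fun hi => by
      simpa using apply_mem_of_mem_permsOn (inv_mem_permsOn hπ) hi⟩
  have := key (π.subtypePerm fun i => (hU i).symm)
  rwa [Equiv.Perm.ofSubtype_subtypePerm] at this
  intro i hi
  by_contra hn
  exact hi (mem_permsOn.1 hπ i hn)

/-- A function with zero average on the orbits of `𝒮_U` is bounded by its swap-Lipschitz
constant. -/
theorem exists_abs_le_of_swapLipschitz (U : Finset (Fin n)) :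
    ∃ M : ℝ, 0 ≤ M ∧ ∀ d h, 0 ≤ d → SwapLipschitz U d h → symmetrize U h = 0 →
      ∀ x, |h x| ≤ M * d := by
  choose! m hm0 hm using exists_swap_length U
  refine ⟨(∑ π ∈ permsOn U, m π) / (permsOn U).card,
    div_nonneg (Finset.sum_nonneg hm0) card_permsOn_pos.le, fun d h hd hh h0 x => ?_⟩
  have e : h x = -(∑ π ∈ permsOn U, (h (permVec π x) - h x)) / (permsOn U).card := by
    have h1 := congrFun h0 x
    rw [symmetrize_apply, Pi.zero_apply, div_eq_zero_iff, or_iff_left card_permsOn_pos.ne'] at h1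
    rw [Finset.sum_sub_distrib, h1, Finset.sum_const, nsmul_eq_mul]
    field_simp [(card_permsOn_pos (J := U)).ne']
    ring
  rw [e, abs_div, abs_neg, abs_of_pos card_permsOn_pos, div_mul_eq_mul_div, Finset.sum_mul]
  gcongr
  exact (Finset.abs_sum_le_sum_abs _ _).trans
    (Finset.sum_le_sum fun π hπ => hm π hπ d h hd hh x)

end Contraction

/-! ### From Lipschitz decay to an L² angle bound. -/

section SpectralGap

variable {n : ℕ} {J K : Finset (Fin n)}

/-- The ratio of the first two terms of a log-convex sequence is at most its growth rate. -/
theorem le_mul_of_sq_le_mul {v : ℕ → ℝ} {C μ : ℝ} (hv : ∀ k, 0 ≤ v k) (hμ : 0 ≤ μ)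
    (hlog : ∀ k, v (k + 1) ^ 2 ≤ v k * v (k + 2)) (hC : ∀ k, v k ≤ C * μ ^ k) :
    v 1 ≤ μ * v 0 := by
  by_contra! hlt
  have h0 : 0 < v 0 := by
    refine (hv 0).lt_of_ne fun h => ?_
    have := hlog 0
    rw [← h] at this hlt
    nlinarith
  set ρ := v 1 / v 0 with hρ
  have hρμ : μ < ρ := (lt_div_iff₀ h0).2 hlt
  have hρ0 : 0 < ρ := hμ.trans_lt hρμ
  have step : ∀ k, 0 < v k ∧ ρ * v k ≤ v (k + 1) := by
    intro k
    induction k with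
    | zero => exact ⟨h0, by rw [hρ, div_mul_cancel₀ _ h0.ne']⟩
    | succ k ih =>
      obtain ⟨hk, hs⟩ := ih
      have hk1 : 0 < v (k + 1) := (mul_pos hρ0 hk).trans_le hs
      refine ⟨hk1, ?_⟩
      have h1 : v k * (ρ * v (k + 1)) ≤ v k * v (k + 2) := by
        have := hlog k
        nlinarith
      exact le_of_mul_le_mul_left h1 hk
  have pw : ∀ k, ρ ^ k * v 0 ≤ v k := by
    intro k
    induction k with
    | zero => simp
    | succ k ih =>
      calc ρ ^ (k + 1) * v 0 = ρ * (ρ ^ k * v 0) := by ring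
        _ ≤ ρ * v k := by gcongr
        _ ≤ v (k + 1) := (step k).2
  rcases hμ.eq_or_lt with rfl | hμ0
  · exact absurd (hC 1) (by simpa using (step 1).1)
  · obtain ⟨k, hk⟩ := pow_unbounded_of_one_lt (C / v 0) ((one_lt_div hμ0).2 hρμ)
    have h1 := (pw k).trans (hC k)
    rw [div_pow, div_lt_div_iff₀ h0 (by positivity)] at hk
    linarith

/-- The square of the maximal correlation between the two families of symmetric functions. -/
noncomputable def gapRatio (J K : Finset (Fin n)) : ℝ :=
  ((K \ J).card / K.card) * ((J \ K).card / J.card)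

theorem gapRatio_nonneg : 0 ≤ gapRatio J K := by
  unfold gapRatio; positivity

/-- The sup norm of `T ^ k h` is `O(gapRatio ^ k)`. Self-adjointness makes `‖T ^ k h‖²` log-convex
in `k`, so the asymptotic rate already bounds the first step. -/
theorem symmetrize_norm_sq_le {h : (Fin n → Bool) → ℝ} (hK : PermInvariant K h)
    (h0 : symmetrize (J ∪ K) h = 0) :
    symmetrize J h ⬝ᵥ symmetrize J h ≤ gapRatio J K * (h ⬝ᵥ h) := by
  set T := symmetrize K ∘ₗ symmetrize J with hT
  have hTinv : ∀ k, PermInvariant K ((T ^ k) h) := by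
    intro k
    cases k with
    | zero => simpa using hK
    | succ k =>
      rw [pow_succ']
      exact permInvariant_symmetrize _
  have hTz : ∀ k, symmetrize (J ∪ K) ((T ^ k) h) = 0 := by
    intro k
    induction k with
    | zero => simpa using h0
    | succ k ih =>
      rw [pow_succ', Module.End.mul_apply, hT, LinearMap.comp_apply,
        symmetrize_symmetrize_of_superset Finset.subset_union_right,
        symmetrize_symmetrize_of_superset Finset.subset_union_left]
      exact ih
  obtain ⟨d, hd, hLip⟩ := exists_swapLipschitz (J ∪ K) h
  have hTLip : ∀ k, SwapLipschitz (J ∪ K) (gapRatio J K ^ k * d) ((T ^ k) h) := by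
    intro k
    induction k with
    | zero => simpa using hLip
    | succ k ih =>
      have hd' : 0 ≤ gapRatio J K ^ k * d := mul_nonneg (pow_nonneg gapRatio_nonneg _) hd
      rw [Finset.union_comm] at ih ⊢
      have h1 := SwapLipschitz.symmetrize hd' (hTinv k) ih
      rw [Finset.union_comm] at h1 ⊢
      have h2 := SwapLipschitz.symmetrize (by positivity) (permInvariant_symmetrize _) h1
      rw [← mul_assoc, ← mul_assoc, ← gapRatio, ← pow_succ'] at h2
      rw [pow_succ' T, Module.End.mul_apply]
      exact h2
  -- On `𝒮_K`-invariant functions `T` agrees with the self-adjoint `P_K P_J P_K`.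
  have hsymm : ∀ u w, PermInvariant K u → PermInvariant K w → T u ⬝ᵥ w = u ⬝ᵥ T w := by
    intro u w hu hw
    rw [hT, LinearMap.comp_apply, LinearMap.comp_apply, symmetrize_dotProduct, hw.symmetrize_eq,
      symmetrize_dotProduct, ← symmetrize_dotProduct (J := K), hu.symmetrize_eq]
  obtain ⟨M, hM, hbound⟩ := exists_abs_le_of_swapLipschitz (J ∪ K)
  have hnorm : (T h) ⬝ᵥ (T h) ≤ gapRatio J K ^ 2 * (h ⬝ᵥ h) := by
    have := le_mul_of_sq_le_mul (v := fun k => (T ^ k) h ⬝ᵥ (T ^ k) h)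
      (C := Fintype.card (Fin n → Bool) * (M * d) ^ 2) (μ := gapRatio J K ^ 2)
      (fun k => dotProduct_self_nonneg_real _) (sq_nonneg _) ?_ ?_
    · simpa using this
    · intro k
      have e : (T ^ (k + 1)) h ⬝ᵥ (T ^ (k + 1)) h = (T ^ k) h ⬝ᵥ (T ^ (k + 2)) h := by
        rw [pow_succ' T (k + 1), Module.End.mul_apply, ← hsymm _ _ (hTinv _) (hTinv _),
          ← Module.End.mul_apply, ← pow_succ']
      simp only [e]
      exact dotProduct_sq_le _ _
    · intro k
      have hb := hbound _ _ (mul_nonneg (pow_nonneg gapRatio_nonneg k) hd) (hTLip k) (hTz k)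
      calc (T ^ k) h ⬝ᵥ (T ^ k) h ≤ ∑ _x : Fin n → Bool, (M * (gapRatio J K ^ k * d)) ^ 2 := by
            refine Finset.sum_le_sum fun x _ => ?_
            rw [← sq, ← sq_abs]
            gcongr
            exact hb x
        _ = _ := by
            rw [Finset.sum_const, nsmul_eq_mul, Finset.card_univ]
            ring
  have e : symmetrize J h ⬝ᵥ symmetrize J h = h ⬝ᵥ T h := by
    rw [symmetrize_dotProduct_symmetrize, hT, LinearMap.comp_apply, ← symmetrize_dotProduct,
      ← symmetrize_dotProduct, hK.symmetrize_eq, symmetrize_dotProduct]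
  rw [e]
  refine abs_le_of_sq_le_sq' ?_ (mul_nonneg gapRatio_nonneg (dotProduct_self_nonneg_real h)) |>.2
  calc (h ⬝ᵥ T h) ^ 2 ≤ (h ⬝ᵥ h) * (T h ⬝ᵥ T h) := dotProduct_sq_le _ _
    _ ≤ (h ⬝ᵥ h) * (gapRatio J K ^ 2 * (h ⬝ᵥ h)) :=
        mul_le_mul_of_nonneg_left hnorm (dotProduct_self_nonneg_real h)
    _ = _ := by ring

/-- On functions with zero average over `𝒮_{J ∪ K}`, the sum of the two projections has norm at
most `1 + √gapRatio`. -/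
theorem dotProduct_symmetrize_add_le {g : (Fin n → Bool) → ℝ}
    (h0 : symmetrize (J ∪ K) g = 0) :
    g ⬝ᵥ symmetrize J g + g ⬝ᵥ symmetrize K g ≤ (1 + √(gapRatio J K)) * (g ⬝ᵥ g) := by
  set ε := √(gapRatio J K) with hε
  have hε0 : 0 ≤ ε := Real.sqrt_nonneg _
  set a := symmetrize J g with ha
  set b := symmetrize K g with hb
  have haa : a ⬝ᵥ a = g ⬝ᵥ a := symmetrize_dotProduct_symmetrize g
  have hbb : b ⬝ᵥ b = g ⬝ᵥ b := symmetrize_dotProduct_symmetrize g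
  have hab : a ⬝ᵥ b = a ⬝ᵥ symmetrize J b := by
    rw [← symmetrize_dotProduct (J := J) a b, ha, symmetrize_self]
  have hJb : symmetrize J b ⬝ᵥ symmetrize J b ≤ ε ^ 2 * (b ⬝ᵥ b) := by
    rw [hε, Real.sq_sqrt gapRatio_nonneg]
    refine symmetrize_norm_sq_le (permInvariant_symmetrize _) ?_
    rw [hb, symmetrize_symmetrize_of_superset Finset.subset_union_right, h0]
  have ha0 := dotProduct_self_nonneg_real a
  have hb0 := dotProduct_self_nonneg_real b
  have hg0 := dotProduct_self_nonneg_real g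
  have hcross : 2 * (a ⬝ᵥ b) ≤ ε * (a ⬝ᵥ a + b ⬝ᵥ b) := by
    refine (abs_le_of_sq_le_sq' ?_ (by positivity)).2
    calc (2 * (a ⬝ᵥ b)) ^ 2 = 4 * (a ⬝ᵥ symmetrize J b) ^ 2 := by rw [hab]; ring
      _ ≤ 4 * ((a ⬝ᵥ a) * (ε ^ 2 * (b ⬝ᵥ b))) := by
          gcongr
          exact (dotProduct_sq_le _ _).trans (mul_le_mul_of_nonneg_left hJb ha0)
      _ ≤ (ε * (a ⬝ᵥ a + b ⬝ᵥ b)) ^ 2 := by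
          nlinarith [mul_nonneg (sq_nonneg ε) (sq_nonneg (a ⬝ᵥ a - b ⬝ᵥ b))]
  rw [← haa, ← hbb]
  set S := a ⬝ᵥ a + b ⬝ᵥ b with hS
  -- Cauchy–Schwarz for `g` and `a + b`, with `‖a + b‖² ≤ (1 + ε) S` by `hcross`.
  have hsq : S ^ 2 ≤ (g ⬝ᵥ g) * ((1 + ε) * S) := by
    calc S ^ 2 = (g ⬝ᵥ (a + b)) ^ 2 := by rw [dotProduct_add, hS, haa, hbb]
      _ ≤ (g ⬝ᵥ g) * ((a + b) ⬝ᵥ (a + b)) := dotProduct_sq_le _ _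
      _ ≤ _ := by
          refine mul_le_mul_of_nonneg_left ?_ hg0
          rw [add_dotProduct, dotProduct_add, dotProduct_add, dotProduct_comm b a]
          linarith
  rcases (add_nonneg ha0 hb0).eq_or_lt with h | h
  · rw [← hS] at h
    rw [← h]
    positivity
  · refine le_of_mul_le_mul_right ?_ h
    rw [← hS]
    linarith

end SpectralGap

/-! ### Symmetric influence as a quadratic form, and the final bound. -/

section Influence

variable {n : ℕ}

/-- The real-valued indicator function of `f`. -/
def boolIndicator (f : (Fin n → Bool) → Bool) : (Fin n → Bool) → ℝ := fun x => if f x then 1 else 0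

theorem symInf_eq (f : (Fin n → Bool) → Bool) (J : Finset (Fin n)) :
    SymInf f J = 2 / 2 ^ n * (boolIndicator f ⬝ᵥ boolIndicator f -
      boolIndicator f ⬝ᵥ symmetrize J (boolIndicator f)) := by
  set F := boolIndicator f with hF
  have hFF : ∀ x, F x * F x = F x := by
    intro x
    simp only [hF, boolIndicator]
    split_ifs <;> simp
  have hind : ∀ x y, (if f x ≠ f y then (1 : ℝ) else 0) = F x + F y - 2 * (F x * F y) := by
    intro x y
    simp only [hF, boolIndicator]
    cases f x <;> cases f y <;> norm_num
  have hnum : ((((Finset.univ : Finset (Fin n → Bool)) ×ˢ permsOn J).filter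
      fun p => f p.1 ≠ f (permVec p.2 p.1)).card : ℝ) =
      2 * (permsOn J).card * (F ⬝ᵥ F - F ⬝ᵥ symmetrize J F) := by
    have h1 : ∑ π ∈ permsOn J, ∑ x, F x * F (permVec π x) =
        (permsOn J).card * (F ⬝ᵥ symmetrize J F) := by
      rw [Finset.sum_comm, dotProduct, Finset.mul_sum]
      refine Finset.sum_congr rfl fun x _ => ?_
      rw [symmetrize_apply, ← Finset.mul_sum]
      field_simp [(card_permsOn_pos (J := J)).ne']
    have h2 : F ⬝ᵥ F = ∑ x, F x := Finset.sum_congr rfl fun x _ => hFF x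
    rw [Finset.card_filter, Nat.cast_sum, Finset.sum_product_right]
    simp only [Nat.cast_ite, Nat.cast_one, Nat.cast_zero, hind, Finset.sum_add_distrib,
      Finset.sum_sub_distrib, ← Finset.mul_sum, sum_permVec]
    rw [h1, h2, Finset.sum_const, nsmul_eq_mul]
    ring
  rw [SymInf, hnum, Finset.card_product, Finset.card_univ]
  simp only [Fintype.card_fun, Fintype.card_bool, Fintype.card_fin, Nat.cast_mul, Nat.cast_pow,
    Nat.cast_ofNat]
  field_simp [(card_permsOn_pos (J := J)).ne']

theorem symInf_le_one (f : (Fin n → Bool) → Bool) (J : Finset (Fin n)) : SymInf f J ≤ 1 := by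
  refine div_le_one_of_le₀ ?_ (by positivity)
  exact_mod_cast Finset.card_filter_le _ _

theorem symInf_nonneg (f : (Fin n → Bool) → Bool) (J : Finset (Fin n)) : 0 ≤ SymInf f J := by
  unfold SymInf; positivity

theorem one_sub_mul_symInf_union_le (f : (Fin n → Bool) → Bool) (J K : Finset (Fin n)) :
    (1 - √(gapRatio J K)) * SymInf f (J ∪ K) ≤ SymInf f J + SymInf f K := by
  set F := boolIndicator f with hF
  set p := symmetrize (J ∪ K) F with hp
  set g := F - p with hg
  have hg0 : symmetrize (J ∪ K) g = 0 := by
    rw [hg, map_sub, hp, symmetrize_self, sub_self]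
  have hgp : g ⬝ᵥ p = 0 := by
    rw [hp, ← symmetrize_dotProduct, hg0, zero_dotProduct]
  have hFp : F = g + p := by rw [hg, sub_add_cancel]
  -- The invariant part `p` is fixed by every `P_L` and orthogonal to `g`, so it cancels.
  have key : ∀ L ⊆ J ∪ K, F ⬝ᵥ F - F ⬝ᵥ symmetrize L F = g ⬝ᵥ g - g ⬝ᵥ symmetrize L g := by
    intro L hL
    have hLp : symmetrize L p = p := symmetrize_symmetrize_of_subset hL F
    have h1 : p ⬝ᵥ symmetrize L g = 0 := by
      rw [← symmetrize_dotProduct, hLp, dotProduct_comm, hgp]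
    rw [hFp, map_add, hLp]
    simp only [dotProduct_add, add_dotProduct, h1, hgp, dotProduct_comm p g]
    ring
  rw [symInf_eq, symInf_eq, symInf_eq, ← hF, key _ subset_rfl, key _ Finset.subset_union_left,
    key _ Finset.subset_union_right, hg0, dotProduct_zero, sub_zero, mul_left_comm, ← mul_add]
  refine mul_le_mul_of_nonneg_left ?_ (by positivity)
  linarith [dotProduct_symmetrize_add_le hg0]

theorem sqrt_gapRatio_le {γ : ℝ} (hγ0 : 0 ≤ γ) (hγ : γ ≤ 1 / 2) {J K : Finset (Fin n)}
    (hJ : (1 - γ) * (n : ℝ) ≤ (J.card : ℝ)) (hK : (1 - γ) * (n : ℝ) ≤ (K.card : ℝ)) :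
    √(gapRatio J K) ≤ 2 * γ := by
  have half : ∀ L M : Finset (Fin n), (1 - γ) * (n : ℝ) ≤ (L.card : ℝ) →
      (1 - γ) * (n : ℝ) ≤ (M.card : ℝ) → ((M \ L).card : ℝ) / M.card ≤ 2 * γ := by
    intro L M hL hM
    refine div_le_of_le_mul₀ (by positivity) (by positivity) ?_
    have h1 : (M \ L).card + L.card ≤ n := by
      rw [← Finset.card_union_of_disjoint Finset.sdiff_disjoint]
      exact (Finset.card_le_univ _).trans_eq (Fintype.card_fin n)
    have h2 : ((M \ L).card : ℝ) + L.card ≤ n := by exact_mod_cast h1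
    have hn : (0 : ℝ) ≤ n := n.cast_nonneg
    -- `|M \ L| ≤ γ n ≤ 2γ(1 - γ) n ≤ 2γ |M|`, using `γ ≤ 1/2`.
    nlinarith [mul_nonneg hγ0 hn]
  refine Real.sqrt_le_iff.2 ⟨by positivity, ?_⟩
  rw [gapRatio, sq]
  exact mul_le_mul (half J K hJ hK) (half K J hK hJ) (by positivity) (by positivity)

end Influence

theorem mainTheorem7 :
    ∃ c : ℝ, ∀ (γ : ℝ), 0 < γ → γ < 1 →
      ∀ (n : ℕ) (f : (Fin n → Bool) → Bool) (J K : Finset (Fin n)),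
        (1 - γ) * (n : ℝ) ≤ (J.card : ℝ) → (1 - γ) * (n : ℝ) ≤ (K.card : ℝ) →
          SymInf f (J ∪ K) ≤ SymInf f J + SymInf f K + c * Real.sqrt γ := by
  -- For `γ ≤ 1/2` the error is at most `√gapRatio ≤ 2γ ≤ 2√γ`; for `γ > 1/2`, `2√γ > 1` makes the
  -- bound trivial.
  refine ⟨2, fun γ hγ0 hγ1 n f J K hJ hK => ?_⟩
  have hU0 := symInf_nonneg f (J ∪ K)
  have hU1 := symInf_le_one f (J ∪ K)
  have hγs : γ ≤ √γ := Real.le_sqrt_of_sq_le (by nlinarith)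
  rcases le_or_gt γ (1 / 2) with hγ | hγ
  · have h1 := one_sub_mul_symInf_union_le f J K
    have h2 := sqrt_gapRatio_le hγ0.le hγ hJ hK
    have h3 : √(gapRatio J K) * SymInf f (J ∪ K) ≤ √(gapRatio J K) :=
      mul_le_of_le_one_right (Real.sqrt_nonneg _) hU1
    linarith
  · linarith [symInf_nonneg f J, symInf_nonneg f K]
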